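/- A $C^\infty$-ring is a set $A$ on which every smooth function $f\colon\mathbb R^n\to\mathbb R$ ($n\ge 0$) acts as an $n$-ary operation $f^A\colon A^n\to A$ in such a way that coordinate projections are sent to coordinate projections and compositions to compositions; interpreting $x+y$, $x\cdot y$, $-x$, $0$, $1$ makes $A$ a commutative ring. A $C^\infty$-field is a $C^\infty$-ring whose underlying ring is a field. On a $C^\infty$-ring $A$ write $a\prec b$ if $b-a=u^2$ for some unit $u\in A^\times$, and $a\preceq b$ if $a\prec b$ or $a=b$. Call a binary relation $r$ on a field a compatible total order if it is reflexive, transitive, antisymmetric and total, if $a\,r\,b$ implies $(a+x)\,r\,(b+x)$ for all $x$, and if $a\,r\,b$ and $0\,r\,x$ imply $(ax)\,r\,(bx)$. **Theorem.** Let $A$ be a $C^\infty$-field. Then: 1. $\preceq$ is a compatible total order on $A$. 2. (Trichotomy) For all $a,b\in A$, exactly one of $a=b$, $a\prec b$, $b\prec a$ holds. 3. $A$ is a Euclidean field: it has exactly one compatible total order (hence $\preceq$), and every element that is nonnegative for this order is a square in $A$. -/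

import Mathlib

open scoped ContDiff

universe u

/-- The ring `C^∞(ℝⁿ, ℝ)` of smooth real functions of `n` real variables
(`n = 0` gives the constants). -/
def smoothFun (n : ℕ) : Subring ((Fin n → ℝ) → ℝ) where
  carrier := {f | ContDiff ℝ ∞ f}
  mul_mem' := by
    intro f g hf hg
    simp only [Set.mem_ofPred_eq] at *
    exact hf.mul hg
  one_mem' := by
    simp only [Set.mem_ofPred_eq]
    exact contDiff_const
  add_mem' := by
    intro f g hf hg
    simp only [Set.mem_ofPred_eq] at *
    exact hf.add hg
  zero_mem' := by
    simp only [Set.mem_ofPred_eq]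
    exact contDiff_const
  neg_mem' := by
    intro f hf
    simp only [Set.mem_ofPred_eq] at *
    exact hf.neg

theorem mem_smoothFun {n : ℕ} {f : (Fin n → ℝ) → ℝ} : f ∈ smoothFun n ↔ ContDiff ℝ ∞ f :=
  Iff.rfl

/-- The `k`-th coordinate projection `ℝⁿ → ℝ`. -/
def smoothFun.proj {n : ℕ} (k : Fin n) : smoothFun n :=
  ⟨fun x => x k, mem_smoothFun.2 (contDiff_apply ℝ ℝ k)⟩

/-- A `C^∞`-ring structure on a set `A`: every smooth `f : ℝⁿ → ℝ` is interpreted as an `n`-ary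
operation on `A`, in such a way that projections and compositions are preserved. -/
class CInftyRing (A : Type u) where
  /-- the interpretation of a smooth function as an operation on `A` -/
  op : {n : ℕ} → smoothFun n → (Fin n → A) → A
  op_proj : ∀ {n : ℕ} (k : Fin n) (a : Fin n → A), op (smoothFun.proj k) a = a k
  op_comp : ∀ {m n : ℕ} (f : smoothFun m) (g : Fin n → smoothFun m) (h : smoothFun n),
    (∀ x : Fin m → ℝ, f.1 x = h.1 (fun i => (g i).1 x)) →
      ∀ a : Fin m → A, op f a = op h (fun i => op (g i) a)

namespace CInftyRing

variable {A : Type u} [CInftyRing A]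

/-! The ring operations of a `C^∞`-ring are the interpretations of the smooth functions
`x + y`, `x * y`, `-x`, `0` and `1`. -/

instance instAdd : Add A := ⟨fun a b => op (smoothFun.proj 0 + smoothFun.proj 1) ![a, b]⟩

instance instMul : Mul A := ⟨fun a b => op (smoothFun.proj 0 * smoothFun.proj 1) ![a, b]⟩

instance instNeg : Neg A := ⟨fun a => op (-smoothFun.proj 0) ![a]⟩

instance instZero : Zero A := ⟨op (0 : smoothFun 0) ![]⟩

instance instOne : One A := ⟨op (1 : smoothFun 0) ![]⟩

theorem op_add {n : ℕ} (f g : smoothFun n) (v : Fin n → A) :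
    op (f + g) v = op f v + op g v := by
  refine (op_comp (f + g) ![f, g] (smoothFun.proj 0 + smoothFun.proj 1) ?_ v).trans ?_
  · intro x; rfl
  · change op _ _ = op _ _
    congr 1
    funext i
    fin_cases i <;> rfl

theorem op_mul {n : ℕ} (f g : smoothFun n) (v : Fin n → A) :
    op (f * g) v = op f v * op g v := by
  refine (op_comp (f * g) ![f, g] (smoothFun.proj 0 * smoothFun.proj 1) ?_ v).trans ?_
  · intro x; rfl
  · change op _ _ = op _ _
    congr 1
    funext i
    fin_cases i <;> rfl

theorem op_neg {n : ℕ} (f : smoothFun n) (v : Fin n → A) : op (-f) v = -op f v := by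
  refine (op_comp (-f) ![f] (-smoothFun.proj 0) ?_ v).trans ?_
  · intro x; rfl
  · change op _ _ = op _ _
    congr 1
    funext i
    fin_cases i; rfl

theorem op_zero {n : ℕ} (v : Fin n → A) : op (0 : smoothFun n) v = 0 := by
  refine (op_comp (0 : smoothFun n) ![] (0 : smoothFun 0) ?_ v).trans ?_
  · intro x; rfl
  · change op _ _ = op _ _
    congr 1
    funext i
    exact i.elim0

theorem op_one {n : ℕ} (v : Fin n → A) : op (1 : smoothFun n) v = 1 := by
  refine (op_comp (1 : smoothFun n) ![] (1 : smoothFun 0) ?_ v).trans ?_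
  · intro x; rfl
  · change op _ _ = op _ _
    congr 1
    funext i
    exact i.elim0

theorem exists_op_eq (a b c : A) : ∃ (v : Fin 3 → A) (p q r : smoothFun 3),
    a = op p v ∧ b = op q v ∧ c = op r v :=
  ⟨![a, b, c], smoothFun.proj 0, smoothFun.proj 1, smoothFun.proj 2,
    (op_proj 0 ![a, b, c]).symm,
    (op_proj 1 ![a, b, c]).symm, (op_proj 2 ![a, b, c]).symm⟩

/-- The underlying commutative ring of a `C^∞`-ring. -/
noncomputable instance instCommRing : CommRing A where
  add_assoc a b c := by
    obtain ⟨v, p, q, r, rfl, rfl, rfl⟩ := exists_op_eq a b c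
    simp only [← op_add, add_assoc]
  zero_add a := by
    obtain ⟨v, p, _, _, rfl, _, _⟩ := exists_op_eq a a a
    rw [← op_zero v, ← op_add, zero_add]
  add_zero a := by
    obtain ⟨v, p, _, _, rfl, _, _⟩ := exists_op_eq a a a
    rw [← op_zero v, ← op_add, add_zero]
  add_comm a b := by
    obtain ⟨v, p, q, _, rfl, rfl, _⟩ := exists_op_eq a b b
    rw [← op_add, ← op_add, add_comm]
  neg_add_cancel a := by
    obtain ⟨v, p, _, _, rfl, _, _⟩ := exists_op_eq a a a
    rw [← op_neg, ← op_add, neg_add_cancel, op_zero]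
  mul_assoc a b c := by
    obtain ⟨v, p, q, r, rfl, rfl, rfl⟩ := exists_op_eq a b c
    simp only [← op_mul, mul_assoc]
  one_mul a := by
    obtain ⟨v, p, _, _, rfl, _, _⟩ := exists_op_eq a a a
    rw [← op_one v, ← op_mul, one_mul]
  mul_one a := by
    obtain ⟨v, p, _, _, rfl, _, _⟩ := exists_op_eq a a a
    rw [← op_one v, ← op_mul, mul_one]
  mul_comm a b := by
    obtain ⟨v, p, q, _, rfl, rfl, _⟩ := exists_op_eq a b b
    rw [← op_mul, ← op_mul, mul_comm]
  zero_mul a := by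
    obtain ⟨v, p, _, _, rfl, _, _⟩ := exists_op_eq a a a
    rw [← op_zero v, ← op_mul, zero_mul]
  mul_zero a := by
    obtain ⟨v, p, _, _, rfl, _, _⟩ := exists_op_eq a a a
    rw [← op_zero v, ← op_mul, mul_zero]
  left_distrib a b c := by
    obtain ⟨v, p, q, r, rfl, rfl, rfl⟩ := exists_op_eq a b c
    simp only [← op_add, ← op_mul, mul_add]
  right_distrib a b c := by
    obtain ⟨v, p, q, r, rfl, rfl, rfl⟩ := exists_op_eq a b c
    simp only [← op_add, ← op_mul, add_mul]
  nsmul := nsmulRec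
  zsmul := zsmulRec

/-- The canonical relation `a ≺ b`: the difference `b - a` is the square of a unit. -/
def CanonicalLT (a b : A) : Prop := ∃ u : Aˣ, b - a = (u : A) ^ 2

/-- The relation `a ⪯ b`: either `a ≺ b` or `a = b`. -/
def CanonicalLE (a b : A) : Prop := CanonicalLT a b ∨ a = b

end CInftyRing

/-- A `C^∞`-field is a `C^∞`-ring whose underlying ring is a field. -/
def IsCInftyField (A : Type u) [CInftyRing A] : Prop := IsField A

/-- `r` is a total (linear) order on the set `K`, compatible with sum and product. -/
structure IsCompatibleTotalOrder {K : Type u} [CommRing K] (r : K → K → Prop) : Prop where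
  refl : ∀ a, r a a
  trans : ∀ a b c, r a b → r b c → r a c
  antisymm : ∀ a b, r a b → r b a → a = b
  total : ∀ a b, r a b ∨ r b a
  add_right : ∀ a b x, r a b → r (a + x) (b + x)
  mul_right : ∀ a b x, r a b → r 0 x → r (a * x) (b * x)

/-- A Euclidean field: it has exactly one total order compatible with sum and product, and every
nonnegative element for that order has a square root in the field. -/
structure IsEuclideanField (K : Type u) [CommRing K] : Prop where
  isField : IsField K
  existsUnique_order : ∃! r : K → K → Prop, IsCompatibleTotalOrder r
  exists_sqrt : ∀ r : K → K → Prop, IsCompatibleTotalOrder r → ∀ x, r 0 x → ∃ y, x = y ^ 2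

namespace CInftyRing

/-! Identities between smooth functions hold in `A`. If `a * b = 1`, then `(a, b)` satisfies the
equation of the hyperbola `x y = 1`, near which `√x` and `√(-x)` (zero for negative argument) are
smooth; cut off, they yield `a = s ^ 2 - t ^ 2` with `s * t = 0` (`exists_eq_sq_sub_sq`). In a field
`s` or `t` vanishes, so `a` or `-a` is a square. Since `1 + x ^ 2 + y ^ 2` is a unit, sums of up to
three squares vanish only trivially. Hence the squares are the nonnegative cone of a total order;
every compatible order contains this one, and nested total orders coincide. -/

/-- A nowhere vanishing smooth function is interpreted as a unit-valued operation. -/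
theorem exists_op_mul_eq_one {A : Type u} [CInftyRing A] {n : ℕ} (f : smoothFun n)
    (hf : ∀ x, f.1 x ≠ 0) (v : Fin n → A) : ∃ b : A, op f v * b = 1 := by
  let g : smoothFun n := ⟨fun x => (f.1 x)⁻¹, mem_smoothFun.2 ((mem_smoothFun.1 f.2).inv hf)⟩
  have hfg : f * g = 1 := Subtype.ext (funext fun x => mul_inv_cancel₀ (hf x))
  exact ⟨op g v, by rw [← op_mul, hfg, op_one]⟩

theorem one_add_sq_add_sq_ne_zero {A : Type u} [CInftyRing A] [Nontrivial A] (x y : A) :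
    1 + x ^ 2 + y ^ 2 ≠ 0 := by
  intro h
  let p : smoothFun 2 := smoothFun.proj 0
  let q : smoothFun 2 := smoothFun.proj 1
  obtain ⟨b, hb⟩ := exists_op_mul_eq_one (1 + p * p + q * q)
    (fun z => by
      have : 0 < 1 + z 0 * z 0 + z 1 * z 1 := by
        nlinarith [mul_self_nonneg (z 0), mul_self_nonneg (z 1)]
      exact this.ne') ![x, y]
  rw [op_add, op_add, op_mul, op_mul, op_one, op_proj, op_proj] at hb
  simp only [Matrix.cons_val_zero, Matrix.cons_val_one] at hb
  rw [← sq, ← sq, h, zero_mul] at hb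
  exact zero_ne_one hb

/-- A smooth function of one variable with value `1` at `1` is interpreted with value `1` wherever
its argument is `1`. -/
theorem op_comp_eq_one {A : Type u} [CInftyRing A] {n : ℕ} {τ : ℝ → ℝ} (hτ : ContDiff ℝ ∞ τ)
    (hτ1 : τ 1 = 1) (f g : smoothFun n) (hf : ∀ x, f.1 x = τ (g.1 x)) (v : Fin n → A)
    (hg : op g v = 1) : op f v = 1 := by
  let t : smoothFun 1 :=
    ⟨fun x => τ (x 0), mem_smoothFun.2 (hτ.comp (contDiff_apply ℝ ℝ (0 : Fin 1)))⟩
  -- Since `op g v = op 1 v`, composing with `τ` gives the value of the constant `τ 1 = 1`.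
  rw [op_comp f (fun _ => g) t hf v, ← op_one v]
  rw [← op_one v] at hg
  rw [hg]
  refine (op_comp (1 : smoothFun n) (fun _ => 1) t (fun x => ?_) v).symm
  exact hτ1.symm

/-- Cutting off `√(ε x)` away from the hyperbola `x y = 1` makes it smooth. -/
theorem contDiff_smoothTransition_mul_sqrt {ε : ℝ} (hε : ε ≠ 0) :
    ContDiff ℝ ∞ fun z : Fin 2 → ℝ =>
      Real.smoothTransition (2 * (z 0 * z 1) - 1) * √(ε * z 0) := by
  have h0 : ContDiff ℝ ∞ fun z : Fin 2 → ℝ => z 0 := contDiff_apply ℝ ℝ (0 : Fin 2)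
  have h1 : ContDiff ℝ ∞ fun z : Fin 2 → ℝ => z 1 := contDiff_apply ℝ ℝ (1 : Fin 2)
  have hq : ContDiff ℝ ∞ fun z : Fin 2 → ℝ => 2 * (z 0 * z 1) - 1 :=
    (contDiff_const.mul (h0.mul h1)).sub contDiff_const
  rw [contDiff_iff_contDiffAt]
  intro z
  by_cases hz : z 0 = 0
  -- Near `z 0 = 0` the cutoff argument is close to `-1`, so the product is locally zero and the
  -- singularity of the root is harmless.
  · have hev : ∀ᶠ w : Fin 2 → ℝ in nhds z, 2 * (w 0 * w 1) - 1 < 0 :=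
      hq.continuous.continuousAt.eventually_lt continuousAt_const (by simp [hz])
    refine (contDiffAt_const (c := (0 : ℝ))).congr_of_eventuallyEq ?_
    filter_upwards [hev] with w hw
    rw [Real.smoothTransition.zero_of_nonpos hw.le, zero_mul]
  · exact (Real.smoothTransition.contDiff.comp hq).contDiffAt.mul
      ((contDiff_const.mul h0).contDiffAt.sqrt (mul_ne_zero hε hz))

/-- An invertible element of a `C^∞`-ring is a difference of squares of orthogonal elements. -/
theorem exists_eq_sq_sub_sq {A : Type u} [CInftyRing A] {a b : A} (hab : a * b = 1) :
    ∃ s t : A, a = s ^ 2 - t ^ 2 ∧ s * t = 0 := by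
  let v : Fin 2 → A := ![a, b]
  let p : smoothFun 2 := smoothFun.proj 0
  let q : smoothFun 2 := smoothFun.proj 1
  -- This is the cutoff argument `2xy - 1`; it takes the value `1` at `(a, b)`, so the cutoff `T`
  -- becomes `1` in `A`.
  let g : smoothFun 2 := p * q + p * q - 1
  have hp : op p v = a := op_proj 0 v
  have hq : op q v = b := op_proj 1 v
  have hg : op g v = 1 := by
    change op (p * q + p * q - 1) v = 1
    rw [sub_eq_add_neg, op_add, op_add, op_mul, op_neg, op_one, hp, hq, hab]
    ring
  have hgx : ∀ z, g.1 z = 2 * (z 0 * z 1) - 1 := fun z => by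
    change z 0 * z 1 + z 0 * z 1 - 1 = _
    ring
  let T : smoothFun 2 := ⟨fun z => Real.smoothTransition (g.1 z),
    mem_smoothFun.2 (Real.smoothTransition.contDiff.comp (mem_smoothFun.1 g.2))⟩
  have hT : op T v = 1 := op_comp_eq_one Real.smoothTransition.contDiff
    Real.smoothTransition.one T g (fun _ => rfl) v hg
  let S : smoothFun 2 := ⟨_, mem_smoothFun.2 (contDiff_smoothTransition_mul_sqrt one_ne_zero)⟩
  let N : smoothFun 2 :=
    ⟨_, mem_smoothFun.2 (contDiff_smoothTransition_mul_sqrt (neg_ne_zero.2 one_ne_zero))⟩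
  have hSN : S * N = 0 := by
    refine Subtype.ext (funext fun z => ?_)
    change (Real.smoothTransition _ * √(1 * z 0)) * (Real.smoothTransition _ * √(-1 * z 0)) = 0
    rcases le_total (z 0) 0 with h | h
    · rw [Real.sqrt_eq_zero_of_nonpos (by linarith : 1 * z 0 ≤ 0)]; ring
    · rw [Real.sqrt_eq_zero_of_nonpos (by linarith : -1 * z 0 ≤ 0)]; ring
  have hSS : S * S = T * T * p + N * N := by
    refine Subtype.ext (funext fun z => ?_)
    change (Real.smoothTransition _ * √(1 * z 0)) * (Real.smoothTransition _ * √(1 * z 0)) =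
      Real.smoothTransition (g.1 z) * Real.smoothTransition (g.1 z) * z 0 +
      (Real.smoothTransition _ * √(-1 * z 0)) * (Real.smoothTransition _ * √(-1 * z 0))
    rw [hgx, mul_mul_mul_comm, mul_mul_mul_comm _ √(-1 * z 0)]
    rcases le_total (z 0) 0 with h | h
    · rw [Real.sqrt_eq_zero_of_nonpos (by linarith : 1 * z 0 ≤ 0),
        Real.mul_self_sqrt (by linarith : 0 ≤ -1 * z 0)]
      ring
    · rw [Real.sqrt_eq_zero_of_nonpos (by linarith : -1 * z 0 ≤ 0),
        Real.mul_self_sqrt (by linarith : 0 ≤ 1 * z 0)]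
      ring
  refine ⟨op S v, op N v, ?_, by rw [← op_mul, hSN, op_zero]⟩
  have h := congrArg (fun f => op f v) hSS
  simp only [op_mul, op_add, hT, hp, one_mul] at h
  rw [sq, sq, h]
  ring

theorem isUnit_of_ne_zero {A : Type u} [CInftyRing A] (hA : IsCInftyField A) {a : A}
    (ha : a ≠ 0) : IsUnit a := by
  obtain ⟨b, hb⟩ := hA.mul_inv_cancel ha
  exact IsUnit.of_mul_eq_one b hb

theorem exists_eq_sq_or_neg_eq_sq {A : Type u} [CInftyRing A] (hA : IsCInftyField A) (a : A) :
    (∃ s, a = s ^ 2) ∨ ∃ s, -a = s ^ 2 := by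
  have := hA.isDomain
  by_cases ha : a = 0
  · exact Or.inl ⟨0, by rw [ha]; ring⟩
  obtain ⟨b, hb⟩ := hA.mul_inv_cancel ha
  obtain ⟨s, t, h, hst⟩ := exists_eq_sq_sub_sq hb
  rcases mul_eq_zero.1 hst with rfl | rfl
  · exact Or.inr ⟨t, by rw [h]; ring⟩
  · exact Or.inl ⟨s, by rw [h]; ring⟩

/-- Dividing by `x ^ 2` reduces to `one_add_sq_add_sq_ne_zero`. Three squares are what transitivity
needs. -/
theorem eq_zero_of_sq_add_sq_add_sq_eq_zero {A : Type u} [CInftyRing A] (hA : IsCInftyField A)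
    {x y z : A} (h : x ^ 2 + y ^ 2 + z ^ 2 = 0) : x = 0 := by
  have := hA.nontrivial
  by_contra hx
  obtain ⟨w, hw⟩ := hA.mul_inv_cancel hx
  refine one_add_sq_add_sq_ne_zero (w * y) (w * z) ?_
  linear_combination w ^ 2 * h - (x * w + 1) * hw

theorem canonicalLE_iff {A : Type u} [CInftyRing A] (hA : IsCInftyField A) {a b : A} :
    CanonicalLE a b ↔ ∃ s : A, b - a = s ^ 2 := by
  constructor
  · rintro (⟨u, hu⟩ | rfl)
    · exact ⟨u, hu⟩
    · exact ⟨0, by ring⟩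
  · rintro ⟨s, hs⟩
    by_cases h0 : s = 0
    · right
      rw [h0] at hs
      linear_combination -hs
    · exact Or.inl ⟨(isUnit_of_ne_zero hA h0).unit, hs⟩

theorem not_canonicalLT_self {A : Type u} [CInftyRing A] (hA : IsCInftyField A) (a : A) :
    ¬ CanonicalLT a a := by
  rintro ⟨u, hu⟩
  have := hA.nontrivial
  rw [sub_self] at hu
  exact (u ^ 2).ne_zero (by rw [Units.val_pow_eq_pow_val, ← hu])

theorem isCompatibleTotalOrder_canonicalLE {A : Type u} [CInftyRing A] (hA : IsCInftyField A) :
    IsCompatibleTotalOrder (CanonicalLE : A → A → Prop) where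
  refl a := Or.inr rfl
  trans a b c hab hbc := by
    rw [canonicalLE_iff hA] at *
    obtain ⟨s, hs⟩ := hab
    obtain ⟨t, ht⟩ := hbc
    rcases exists_eq_sq_or_neg_eq_sq hA (c - a) with h | ⟨w, hw⟩
    · exact h
    -- If `c - a = -w ^ 2`, then `w ^ 2 + s ^ 2 + t ^ 2 = 0`, which forces `c = a`.
    · have h1 : w = 0 := eq_zero_of_sq_add_sq_add_sq_eq_zero hA (y := s) (z := t)
        (by linear_combination -hs - ht - hw)
      exact ⟨0, by rw [h1] at hw; linear_combination -hw⟩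
  antisymm a b hab hba := by
    rw [canonicalLE_iff hA] at *
    obtain ⟨s, hs⟩ := hab
    obtain ⟨t, ht⟩ := hba
    have h1 : s = 0 := eq_zero_of_sq_add_sq_add_sq_eq_zero hA (y := t) (z := 0)
      (by linear_combination -hs - ht)
    rw [h1] at hs
    linear_combination -hs
  total a b := by
    rw [canonicalLE_iff hA, canonicalLE_iff hA, ← neg_sub b a]
    exact exists_eq_sq_or_neg_eq_sq hA (b - a)
  add_right a b x hab := by
    rw [canonicalLE_iff hA] at *
    simpa using hab
  mul_right a b x hab hx := by
    rw [canonicalLE_iff hA] at *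
    obtain ⟨s, hs⟩ := hab
    obtain ⟨t, ht⟩ := hx
    exact ⟨s * t, by linear_combination x * hs + s ^ 2 * ht⟩

end CInftyRing

namespace IsCompatibleTotalOrder

theorem zero_le_sq {K : Type u} [CommRing K] {r : K → K → Prop}
    (hr : IsCompatibleTotalOrder r) (s : K) : r 0 (s ^ 2) := by
  rcases hr.total 0 s with h | h
  · simpa [sq] using hr.mul_right 0 s s h h
  · have h' : r 0 (-s) := by simpa using hr.add_right s 0 (-s) h
    simpa [sq] using hr.mul_right 0 (-s) (-s) h' h'

/-- Two compatible total orders, one contained in the other, coincide. -/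
theorem eq_of_le {K : Type u} [CommRing K] {r r' : K → K → Prop}
    (hr : IsCompatibleTotalOrder r) (hr' : IsCompatibleTotalOrder r')
    (h : ∀ a b, r' a b → r a b) : r = r' := by
  funext a b
  refine propext ⟨fun hab => ?_, h a b⟩
  rcases hr'.total a b with h1 | h1
  · exact h1
  · rw [hr.antisymm a b hab (h b a h1)]
    exact hr'.refl b

/-- Squares are nonnegative in any compatible order, so `r` contains the canonical order; totality
of the latter excludes anything more. -/
theorem eq_canonicalLE {A : Type u} [CInftyRing A] (hA : IsCInftyField A)
    {r : A → A → Prop} (hr : IsCompatibleTotalOrder r) : r = CInftyRing.CanonicalLE := by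
  refine hr.eq_of_le (CInftyRing.isCompatibleTotalOrder_canonicalLE hA) fun a b hab => ?_
  obtain ⟨s, hs⟩ := (CInftyRing.canonicalLE_iff hA).1 hab
  have h := hr.add_right _ _ a (hr.zero_le_sq s)
  rwa [← hs, zero_add, sub_add_cancel] at h

end IsCompatibleTotalOrder

theorem theorem4p3 {A : Type u} [CInftyRing A] (hA : IsCInftyField A) :
    IsCompatibleTotalOrder (CInftyRing.CanonicalLE : A → A → Prop) ∧
    (∀ a b : A,
      (a = b ∧ ¬ CInftyRing.CanonicalLT a b ∧ ¬ CInftyRing.CanonicalLT b a) ∨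
      (CInftyRing.CanonicalLT a b ∧ a ≠ b ∧ ¬ CInftyRing.CanonicalLT b a) ∨
      (CInftyRing.CanonicalLT b a ∧ a ≠ b ∧ ¬ CInftyRing.CanonicalLT a b)) ∧
    IsEuclideanField A := by
  have hle := CInftyRing.isCompatibleTotalOrder_canonicalLE hA
  have hirr := CInftyRing.not_canonicalLT_self hA
  refine ⟨hle, fun a b => ?_, hA, ⟨_, hle, fun r hr => hr.eq_canonicalLE hA⟩, fun r hr x hx => ?_⟩
  · by_cases hab : a = b
    · subst hab
      exact Or.inl ⟨rfl, hirr a, hirr a⟩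
    have hasymm : ∀ h : CInftyRing.CanonicalLT a b, ¬ CInftyRing.CanonicalLT b a :=
      fun h h' => hab (hle.antisymm a b (Or.inl h) (Or.inl h'))
    rcases hle.total a b with (h | h) | (h | h)
    · exact Or.inr (Or.inl ⟨h, hab, hasymm h⟩)
    · exact absurd h hab
    · exact Or.inr (Or.inr ⟨h, hab, fun h' => hasymm h' h⟩)
    · exact absurd h.symm hab
  · rw [hr.eq_canonicalLE hA, CInftyRing.canonicalLE_iff hA] at hx
    simpa using hx
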